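/- Theorem (Frankl--Wilson, subspaces). Let $q$ be a prime power and let $n,k$ be integers with $1\le k<n/2$. Let $\mathcal F$ be a family of $k$-dimensional subspaces of $\mathbb F_q^n$ that is intersecting, i.e. $\dim(S\cap T)\neq 0$ for all $S,T\in\mathcal F$. Then $$|\mathcal F|\le {n-1\brack k-1}_q ,$$ where ${m\brack r}_q=\frac{[m]_q!}{[m-r]_q!\,[r]_q!}$ for $0\le r\le m$, with $[i]_q=\frac{1-q^i}{1-q}$ and $[m]_q!=[1]_q[2]_q\cdots[m]_q$. Moreover, equality holds if and only if there is a $1$-dimensional subspace $\ell$ of $\mathbb F_q^n$ such that $\mathcal F$ is the family of all $k$-dimensional subspaces of $\mathbb F_q^n$ that contain $\ell$. -/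

import Mathlib

namespace SubspaceEKR

/-- The `q`-bracket `[n]_q = (1 - q ^ n) / (1 - q)`, for a natural number `q ≥ 2`. -/
def qBracket (q n : ℕ) : ℚ := (1 - (q : ℚ) ^ n) / (1 - (q : ℚ))

/-- The `q`-factorial `[n]_q! = [1]_q [2]_q ⋯ [n]_q`. -/
def qFactorial (q n : ℕ) : ℚ := ∏ i ∈ Finset.Icc 1 n, qBracket q i

/-- The Gaussian binomial coefficient `[n]_q! / ([n - k]_q! [k]_q!)` for `k ≤ n`
(and `0` for `k > n`). -/
def gaussianBinomial (q n k : ℕ) : ℚ :=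
  if k ≤ n then qFactorial q n / (qFactorial q (n - k) * qFactorial q k) else 0

/-- The set of all `k`-dimensional subspaces of `K ^ n`. -/
def subspacesOfDim (K : Type*) [Field K] (n k : ℕ) : Set (Submodule K (Fin n → K)) :=
  {S | Module.finrank K S = k}

/-- Two subspaces of `K ^ n` are skew if their intersection has dimension `0`. -/
def Skew {K : Type*} [Field K] {n : ℕ} (S T : Submodule K (Fin n → K)) : Prop :=
  Module.finrank K (S ⊓ T : Submodule K (Fin n → K)) = 0

/-- A family of subspaces is intersecting if no two of its members are skew. -/
def IsIntersecting {K : Type*} [Field K] {n : ℕ}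
    (𝓕 : Set (Submodule K (Fin n → K))) : Prop :=
  ∀ S ∈ 𝓕, ∀ T ∈ 𝓕, ¬ Skew S T

/-- A family is canonically intersecting (among the `k`-dimensional subspaces) if it consists of
all `k`-dimensional subspaces that contain some fixed `1`-dimensional subspace. -/
def IsCanonicallyIntersecting {K : Type*} [Field K] {n : ℕ} (k : ℕ)
    (𝓕 : Set (Submodule K (Fin n → K))) : Prop :=
  ∃ ℓ ∈ subspacesOfDim K n 1, 𝓕 = {S ∈ subspacesOfDim K n k | ℓ ≤ S}

end SubspaceEKR

/-! The proof is Hoffman's ratio bound for the graph on `k`-subspaces whose edges are skew pairs. An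
intersecting family is an independent set, so its indicator `f` satisfies `⟪D f, f⟫ = 0` for the
adjacency operator `D`.

The spectrum of `D` is read off a flag: `U j` is spanned by the indicators of the families `{S | X ≤
S}` with `dim X < j`. Möbius inversion on the subspace lattice shows that `D` acts on `U (j + 1) / U
j` as a scalar `l j` of sign `(-1) ^ j` (`skewOperator_sub_smul_mem`). Since `D` is symmetric, these
scalars are eigenvalues on the orthogonal layers, and no eigenbasis or multiplicity is needed. For
`j ≥ 1` their moduli decrease strictly, so `l 1` is strictly the least (`skewEigenvalue_one_lt`).
`flag_ratio_bound` then gives the upper bound, and equality forces `f ∈ U 2`.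

A function in `U 2` has the form `f S = ∑ g v` over the nonzero `v ∈ S`, with `g` constant on lines
through `0`. If the members of the family had no common nonzero vector, each nonzero `u` in a member
`S₀` would be missed by some member `S`. As `2 * k + 1 ≤ n`, some `(k + 1)`-subspace `W` contains
`u` and is skew to `S`. No hyperplane of `W` is then in the family, so `g` sums to zero on each of
them, whence `g u = 0` (`eq_zero_of_hyperplane_sums`). This contradicts `f S₀ = 1`. -/

namespace SubspaceEKR

set_option linter.unusedSectionVars false

open Module Finset
open scoped Classical

/-! ### Counting subspaces over a finite field; Möbius inversion -/

section Counting

variable {K V : Type*} [Field K] [AddCommGroup V] [Module K V] [Finite V]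

noncomputable instance : Fintype (Submodule K V) := Fintype.ofFinite _

/-- The `k`-dimensional subspaces between `X` and `W` that meet `S` trivially. -/
noncomputable def skewExtensions (S X W : Submodule K V) (k : ℕ) : Finset (Submodule K V) :=
  {T | finrank K T = k ∧ X ≤ T ∧ T ≤ W ∧ Disjoint T S}

lemma mem_skewExtensions {S X W T : Submodule K V} {k : ℕ} :
    T ∈ skewExtensions S X W k ↔ finrank K T = k ∧ X ≤ T ∧ T ≤ W ∧ Disjoint T S := by
  simp [skewExtensions]

/-- The number of `k`-dimensional subspaces of a `w`-dimensional space that contain a given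
`j`-dimensional subspace and meet trivially a given `s`-dimensional subspace skew to it. -/
noncomputable def skewCount (q w s j k : ℕ) : ℝ :=
  ∏ i ∈ Ico j k, ((q : ℝ) ^ w - (q : ℝ) ^ (s + i)) / ((q : ℝ) ^ k - (q : ℝ) ^ i)

lemma skewCount_self (q w s k : ℕ) : skewCount q w s k k = 1 := by simp [skewCount]

lemma one_lt_card_real [Finite K] : (1 : ℝ) < Nat.card K := by
  exact_mod_cast Finite.one_lt_card

lemma skewCount_succ {q : ℕ} (hq : (1 : ℝ) < q) (w s : ℕ) {j k : ℕ} (h : j < k) :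
    skewCount q w s j k * ((q : ℝ) ^ k - (q : ℝ) ^ j) =
      ((q : ℝ) ^ w - (q : ℝ) ^ (s + j)) * skewCount q w s (j + 1) k := by
  have : (q : ℝ) ^ j < (q : ℝ) ^ k := pow_lt_pow_right₀ hq h
  rw [skewCount, skewCount, Finset.prod_eq_prod_Ico_succ_bot h]
  have : (q : ℝ) ^ k - (q : ℝ) ^ j ≠ 0 := by linarith
  field_simp

lemma skewCount_pos {q : ℕ} (hq : (1 : ℝ) < q) {w s : ℕ} (j : ℕ) {k : ℕ} (h : s + k ≤ w) :
    0 < skewCount q w s j k := by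
  refine Finset.prod_pos fun i hi => div_pos ?_ ?_
  · exact sub_pos.2 (pow_lt_pow_right₀ hq (by have := mem_Ico.1 hi; omega))
  · exact sub_pos.2 (pow_lt_pow_right₀ hq (by have := mem_Ico.1 hi; omega))

lemma finrank_sup_span_singleton {X : Submodule K V} {v : V} (hv : v ∉ X) :
    finrank K (X ⊔ Submodule.span K {v} : Submodule K V) = finrank K X + 1 := by
  have h0 : v ≠ 0 := fun h => hv (h ▸ X.zero_mem)
  have := Submodule.finrank_sup_add_finrank_inf_eq X (Submodule.span K {v})
  have hd : Disjoint X (Submodule.span K {v}) := (Submodule.disjoint_span_singleton' h0).2 hv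
  rw [disjoint_iff.1 hd, finrank_bot, finrank_span_singleton h0] at this
  simpa using this

lemma disjoint_sup_span_singleton {X S : Submodule K V} {v : V} (h : Disjoint X S)
    (hv : v ∉ X ⊔ S) : Disjoint (X ⊔ Submodule.span K {v}) S := by
  have h0 : v ≠ 0 := fun h => hv (h ▸ Submodule.zero_mem _)
  rw [sup_comm]
  exact h.disjoint_sup_left_of_disjoint_sup_right
    ((Submodule.disjoint_span_singleton' h0).2 hv).symm

variable [Fintype V]

lemma card_vectors (T : Submodule K V) :
    (#{v : V | v ∈ T} : ℝ) = (Nat.card K : ℝ) ^ finrank K T := by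
  have h := Module.natCard_eq_pow_finrank (K := K) (V := T)
  rw [← Nat.cast_pow, ← h, ← Fintype.card_subtype, Nat.card_eq_fintype_card]

lemma card_vectors_diff {X T : Submodule K V} (h : X ≤ T) :
    (#{v : V | v ∈ T ∧ v ∉ X} : ℝ) =
      (Nat.card K : ℝ) ^ finrank K T - (Nat.card K : ℝ) ^ finrank K X := by
  rw [← card_vectors, ← card_vectors, eq_sub_iff_add_eq]
  norm_cast
  rw [← card_union_of_disjoint]
  · congr 1
    ext v
    simp only [mem_union, mem_filter, mem_univ, true_and]
    have := @h v
    tauto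
  · rw [Finset.disjoint_left]
    simp +contextual

lemma card_vectors_ne_zero (T : Submodule K V) :
    (#{v : V | v ∈ T ∧ v ≠ 0} : ℝ) = (Nat.card K : ℝ) ^ finrank K T - 1 := by
  have := card_vectors_diff (bot_le : ⊥ ≤ T)
  simpa using this

variable [Finite K]

/-- Double count the pairs `(T, v)` with `v ∈ T \ X`. Since `T` is skew to `S` and contains `X`,
such a `v` lies outside `X ⊔ S`. Conversely, for fixed `v ∈ W` outside `X ⊔ S`, the subspaces `T`
through `v` are the extensions of `X ⊔ span {v}`, which is still skew to `S`. This matches the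
recursion `skewCount_succ`. -/
theorem card_skewExtensions_of_add_eq {S W : Submodule K V} (hS : S ≤ W) {k : ℕ} (m : ℕ) :
    ∀ {X : Submodule K V}, X ≤ W → Disjoint X S → finrank K X + m = k →
    (#(skewExtensions S X W k) : ℝ) =
      skewCount (Nat.card K) (finrank K W) (finrank K S) (finrank K X) k := by
  induction m with
  | zero =>
    intro X hX hd hk
    have : skewExtensions S X W k = {X} := by
      ext T
      rw [mem_skewExtensions, mem_singleton]
      constructor
      · rintro ⟨h1, h2, -, -⟩
        exact (Submodule.eq_of_le_of_finrank_eq h2 (by omega)).symm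
      · rintro rfl
        exact ⟨by omega, le_rfl, hX, hd⟩
    rw [this, show finrank K X = k by omega, skewCount_self]
    simp
  | succ m ih =>
    intro X hX hd hk
    have hlt : finrank K X < k := by omega
    have hq := one_lt_card_real (K := K)
    have hpos : (0 : ℝ) < (Nat.card K : ℝ) ^ k - (Nat.card K : ℝ) ^ finrank K X :=
      sub_pos.2 (pow_lt_pow_right₀ hq hlt)
    refine mul_right_cancel₀ hpos.ne' ?_
    rw [skewCount_succ hq _ _ hlt]
    have h1 : (#(skewExtensions S X W k) : ℝ) *
        ((Nat.card K : ℝ) ^ k - (Nat.card K : ℝ) ^ finrank K X) =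
        ∑ T ∈ skewExtensions S X W k, (#{v ∈ ({v : V | v ∈ W ∧ v ∉ X ⊔ S} : Finset V) | v ∈ T} : ℝ) := by
      rw [← nsmul_eq_mul, ← sum_const]
      refine sum_congr rfl fun T hT => ?_
      obtain ⟨hTk, hXT, hTW, hTS⟩ := mem_skewExtensions.1 hT
      rw [← hTk, ← card_vectors_diff hXT]
      congr 2
      ext v
      simp only [mem_filter, mem_univ, true_and]
      constructor
      · rintro ⟨hv, hvX⟩
        refine ⟨⟨hTW hv, fun hvXS => hvX ?_⟩, hv⟩
        obtain ⟨x, hx, s, hs, rfl⟩ := Submodule.mem_sup.1 hvXS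
        have : s ∈ T := by simpa using T.sub_mem hv (hXT hx)
        have : s = 0 := Submodule.disjoint_def.1 hTS s this hs
        simpa [this] using hx
      · rintro ⟨⟨-, hv⟩, hvT⟩
        exact ⟨hvT, fun h => hv (Submodule.mem_sup_left h)⟩
    have h2 : ∀ v ∈ ({v : V | v ∈ W ∧ v ∉ X ⊔ S} : Finset V),
        (#{T ∈ skewExtensions S X W k | v ∈ T} : ℝ) =
        skewCount (Nat.card K) (finrank K W) (finrank K S) (finrank K X + 1) k := by
      intro v hv
      simp only [mem_filter, mem_univ, true_and] at hv
      obtain ⟨hvW, hv⟩ := hv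
      have hvX : v ∉ X := fun h => hv (Submodule.mem_sup_left h)
      rw [← finrank_sup_span_singleton hvX, ← ih (X := X ⊔ Submodule.span K {v})
        (sup_le hX (by simpa using hvW)) (disjoint_sup_span_singleton hd hv)
        (by rw [finrank_sup_span_singleton hvX]; omega)]
      congr 2
      ext T
      simp only [mem_filter, mem_skewExtensions, sup_le_iff, Submodule.span_singleton_le_iff_mem]
      tauto
    have h3 : finrank K (X ⊔ S : Submodule K V) = finrank K S + finrank K X := by
      have := Submodule.finrank_sup_add_finrank_inf_eq X S
      rw [disjoint_iff.1 hd, finrank_bot] at this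
      omega
    have h4 := sum_card_bipartiteAbove_eq_sum_card_bipartiteBelow
      (s := skewExtensions S X W k) (t := ({v : V | v ∈ W ∧ v ∉ X ⊔ S} : Finset V))
      (fun T v => v ∈ T)
    simp only [bipartiteAbove, bipartiteBelow] at h4
    rw [h1, ← Nat.cast_sum, h4, Nat.cast_sum, sum_congr rfl h2, sum_const, nsmul_eq_mul,
      card_vectors_diff (sup_le hX hS), h3]

lemma card_skewExtensions {S X W : Submodule K V} (hS : S ≤ W) (hX : X ≤ W) (hd : Disjoint X S)
    {k : ℕ} (hk : finrank K X ≤ k) :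
    (#(skewExtensions S X W k) : ℝ) =
      skewCount (Nat.card K) (finrank K W) (finrank K S) (finrank K X) k :=
  card_skewExtensions_of_add_eq hS (k - finrank K X) hX hd (by omega)

/-- The Möbius function of the lattice of subspaces of a vector space over a field with `q`
elements, on an interval of length `d`. -/
noncomputable def subspaceMu (q d : ℕ) : ℝ := (-1) ^ d * (q : ℝ) ^ (d.choose 2)

lemma subspaceMu_succ (q d : ℕ) : subspaceMu q (d + 1) = -((q : ℝ) ^ d * subspaceMu q d) := by
  simp only [subspaceMu, Nat.choose_succ_succ' d 1, Nat.choose_one_right, pow_add]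
  ring

lemma skewCount_hyperplane {q : ℕ} (hq : (1 : ℝ) < q) (d : ℕ) :
    skewCount q (d + 1) 1 0 d = (q : ℝ) ^ d := by
  rw [skewCount, prod_congr rfl (g := fun _ => (q : ℝ)), prod_const]
  · simp
  · intro i hi
    have : (q : ℝ) ^ i < (q : ℝ) ^ d := pow_lt_pow_right₀ hq (by have := mem_Ico.1 hi; omega)
    rw [div_eq_iff (by linarith)]
    ring

/-- For `Z ≠ ⊥` fix a nonzero `v ∈ Z` and group the subspaces `X` avoiding `v` by `Y = X ⊔ span
{v}`. A `Y` of dimension `d + 1` arises from `q ^ d` such `X`, namely its hyperplanes avoiding `v`,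
and their total weight cancels that of `Y` by `subspaceMu_succ`. -/
theorem sum_subspaceMu (Z : Submodule K V) :
    ∑ Y : Submodule K V with Y ≤ Z, subspaceMu (Nat.card K) (finrank K Y) =
      if Z = ⊥ then 1 else 0 := by
  split_ifs with hZ
  · subst hZ
    have : (univ.filter fun Y : Submodule K V => Y ≤ ⊥) = {⊥} := by ext; simp
    rw [this, sum_singleton, finrank_bot]
    simp [subspaceMu]
  · obtain ⟨v, hvZ, hv⟩ := Submodule.exists_mem_ne_zero_of_ne_bot hZ
    have hq := one_lt_card_real (K := K)
    rw [← sum_filter_add_sum_filter_not _ (fun Y : Submodule K V => v ∈ Y), add_comm,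
      ← eq_neg_iff_add_eq_zero, ← sum_neg_distrib,
      ← sum_fiberwise_of_maps_to (t := {Y ∈ ({Y | Y ≤ Z} : Finset (Submodule K V)) | v ∈ Y})
        (g := fun Y => Y ⊔ Submodule.span K {v})]
    · refine sum_congr rfl fun Y hY => ?_
      simp only [mem_filter, mem_univ, true_and] at hY
      obtain ⟨hYZ, hvY⟩ := hY
      obtain ⟨d, hd⟩ : ∃ d, finrank K Y = d + 1 := by
        refine Nat.exists_eq_succ_of_ne_zero fun h => hv ?_
        rw [Submodule.finrank_eq_zero] at h
        simpa [h] using hvY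
      have hset : ({X ∈ ({X ∈ ({X | X ≤ Z} : Finset (Submodule K V)) | v ∉ X}) |
          X ⊔ Submodule.span K {v} = Y} : Finset (Submodule K V)) =
          skewExtensions (Submodule.span K {v}) ⊥ Y d := by
        ext X
        simp only [mem_filter, mem_univ, true_and, mem_skewExtensions, bot_le,
          Submodule.disjoint_span_singleton' hv]
        constructor
        · rintro ⟨⟨-, h2⟩, rfl⟩
          rw [finrank_sup_span_singleton h2] at hd
          exact ⟨by omega, le_sup_left, h2⟩
        · rintro ⟨h1, h2, h3⟩
          refine ⟨⟨h2.trans hYZ, h3⟩, Submodule.eq_of_le_of_finrank_eq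
            (sup_le h2 (by simpa using hvY)) ?_⟩
          rw [finrank_sup_span_singleton h3]
          omega
      rw [hset, sum_congr rfl (g := fun _ => subspaceMu (Nat.card K) d), sum_const, nsmul_eq_mul,
        card_skewExtensions (by simpa using hvY) bot_le disjoint_bot_left (by simp),
        finrank_span_singleton hv, finrank_bot, hd, skewCount_hyperplane hq, subspaceMu_succ]
      · ring
      · intro X hX
        rw [(mem_skewExtensions.1 hX).1]
    · intro Y hY
      simp only [mem_filter, mem_univ, true_and] at hY ⊢
      exact ⟨sup_le hY.1 (by simpa using hvZ),
        Submodule.mem_sup_right (Submodule.mem_span_singleton_self v)⟩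

end Counting

/-! ### The ratio bound for a symmetric operator acting by scalars on a flag -/

section Spectral

open scoped InnerProductSpace

variable {E : Type*} [NormedAddCommGroup E] [InnerProductSpace ℝ E] [FiniteDimensional ℝ E]

/-- A symmetric operator that acts on the successive quotients of a flag `U` as the scalars `l j`
acts as `l m` on the orthogonal complement of `U m` in `U (m + 1)`. -/
lemma eq_smul_of_mem_flag {D : E →ₗ[ℝ] E} (hD : D.IsSymmetric) {U : ℕ → Submodule ℝ E}
    (hU : Monotone U) {l : ℕ → ℝ} (hU0 : U 0 = ⊥)
    (h : ∀ j, ∀ x ∈ U (j + 1), D x - l j • x ∈ U j)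
    {m : ℕ} {z : E} (hz : z ∈ U (m + 1)) (hz' : z ∈ (U m)ᗮ) : D z = l m • z := by
  have hmap : ∀ x ∈ U m, D x ∈ U m := by
    intro x hx
    cases m with
    | zero => rw [hU0, Submodule.mem_bot] at hx ⊢; simp [hx]
    | succ m =>
      have := (U (m + 1)).add_mem (hU m.le_succ (h m x hx)) ((U (m + 1)).smul_mem (l m) hx)
      simpa using this
  -- `D z - l m • z` lies in `U m` by hypothesis, and in its orthogonal complement because `D` is
  -- symmetric and preserves `U m`.
  rw [← sub_eq_zero]
  refine Submodule.disjoint_def.1 (U m).orthogonal_disjoint _ (h m z hz) ?_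
  rw [Submodule.mem_orthogonal] at hz' ⊢
  intro u hu
  rw [inner_sub_right, inner_smul_right, hz' u hu, ← hD, hz' _ (hmap u hu)]
  simp

lemma exists_add_of_mem_flag {U : ℕ → Submodule ℝ E} (hU : Monotone U) {m : ℕ} {x : E}
    (hx : x ∈ U (m + 1)) : ∃ y ∈ U m, ∃ z ∈ U (m + 1), z ∈ (U m)ᗮ ∧ x = y + z := by
  obtain ⟨y, hy, z, hz, rfl⟩ := (U m).exists_add_mem_mem_orthogonal x
  refine ⟨y, hy, z, ?_, hz, rfl⟩
  simpa using (U (m + 1)).sub_mem hx (hU m.le_succ hy)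

/-- If all scalars by which `D` acts on the quotients of the flag beyond `U r` exceed `t`, then
the quadratic form of `D - t` is positive definite on the part of the flag orthogonal to `U r`. -/
lemma flag_quadratic_form {D : E →ₗ[ℝ] E} (hD : D.IsSymmetric) {U : ℕ → Submodule ℝ E}
    (hU : Monotone U) {l : ℕ → ℝ} (hU0 : U 0 = ⊥)
    (h : ∀ j, ∀ x ∈ U (j + 1), D x - l j • x ∈ U j) {r : ℕ} {t : ℝ} (m : ℕ)
    (hl : ∀ j, r ≤ j → j < m → t < l j) (hrm : r ≤ m) :
    ∀ x ∈ U m, x ∈ (U r)ᗮ →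
      t * ⟪x, x⟫_ℝ ≤ ⟪D x, x⟫_ℝ ∧ (⟪D x, x⟫_ℝ = t * ⟪x, x⟫_ℝ → x = 0) := by
  induction m, hrm using Nat.le_induction with
  | base =>
    intro x hx hx'
    have : x = 0 := Submodule.disjoint_def.1 (U r).orthogonal_disjoint x hx hx'
    simp [this]
  | succ m hm ih =>
    intro x hx hx'
    obtain ⟨y, hy, z, hz, hz', rfl⟩ := exists_add_of_mem_flag hU hx
    have hDz := eq_smul_of_mem_flag hD hU hU0 h hz hz'
    have hzr : z ∈ (U r)ᗮ := Submodule.orthogonal_le (hU hm) hz'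
    have hyr : y ∈ (U r)ᗮ := by simpa using (U r)ᗮ.sub_mem hx' hzr
    obtain ⟨h1, h2⟩ := ih (fun j h1 h2 => hl j h1 (by omega)) y hy hyr
    have hyz : ⟪y, z⟫_ℝ = 0 := (Submodule.mem_orthogonal _ _).1 hz' y hy
    have hzy : ⟪z, y⟫_ℝ = 0 := by rw [real_inner_comm, hyz]
    have hDyz : ⟪D y, z⟫_ℝ = 0 := by rw [hD, hDz, inner_smul_right, hyz, mul_zero]
    have e1 : ⟪D (y + z), y + z⟫_ℝ = ⟪D y, y⟫_ℝ + l m * ⟪z, z⟫_ℝ := by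
      rw [map_add, inner_add_left, inner_add_right, inner_add_right, hDyz, hDz,
        inner_smul_left, inner_smul_left, hzy]
      simp
    have e2 : ⟪y + z, y + z⟫_ℝ = ⟪y, y⟫_ℝ + ⟪z, z⟫_ℝ := by
      rw [inner_add_left, inner_add_right, inner_add_right, hyz, hzy]
      ring
    have hlm := hl m hm m.lt_succ_self
    have hz0 : 0 ≤ ⟪z, z⟫_ℝ := real_inner_self_nonneg
    have h3 : t * ⟪z, z⟫_ℝ ≤ l m * ⟪z, z⟫_ℝ := mul_le_mul_of_nonneg_right hlm.le hz0
    rw [e1, e2, mul_add]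
    refine ⟨by linarith, fun heq => ?_⟩
    have hz1 : ⟪z, z⟫_ℝ = 0 := by
      by_contra hne
      have := mul_lt_mul_of_pos_right hlm (lt_of_le_of_ne hz0 (Ne.symm hne))
      linarith
    rw [inner_self_eq_zero.1 hz1, h2 (by rw [hz1] at heq; linarith), add_zero]

/-- A weighted form of the ratio bound, for an operator given by its action on a flag. -/
theorem flag_ratio_bound {D : E →ₗ[ℝ] E} (hD : D.IsSymmetric) {U : ℕ → Submodule ℝ E}
    (hU : Monotone U) {l : ℕ → ℝ} (hU0 : U 0 = ⊥)
    (h : ∀ j, ∀ x ∈ U (j + 1), D x - l j • x ∈ U j) {k : ℕ} (hk : 1 ≤ k)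
    (htop : U (k + 1) = ⊤) (hl : ∀ j, 2 ≤ j → j ≤ k → l 1 < l j) {e : E} (he : U 1 = ℝ ∙ e)
    {f : E} (hf : ⟪D f, f⟫_ℝ = 0) :
    (l 0 - l 1) * ⟪e, f⟫_ℝ ^ 2 ≤ -l 1 * ⟪f, f⟫_ℝ * ⟪e, e⟫_ℝ ∧
      ((l 0 - l 1) * ⟪e, f⟫_ℝ ^ 2 = -l 1 * ⟪f, f⟫_ℝ * ⟪e, e⟫_ℝ → e ≠ 0 → f ∈ U 2) := by
  -- Split `f = c • e + b + z` orthogonally: `e` and `b` satisfy the eigenvector equations for `l 0`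
  -- and `l 1`, and `z` is orthogonal to `U 2`.
  obtain ⟨y, hy, z, hz', rfl⟩ := (U 2).exists_add_mem_mem_orthogonal f
  obtain ⟨a, ha, b, hb, hb', rfl⟩ := exists_add_of_mem_flag hU hy
  rw [he] at ha
  obtain ⟨c, rfl⟩ := Submodule.mem_span_singleton.1 ha
  have heU : e ∈ U 1 := he ▸ Submodule.mem_span_singleton_self e
  have hDe : D e = l 0 • e :=
    eq_smul_of_mem_flag hD hU hU0 h heU (by rw [hU0, Submodule.bot_orthogonal_eq_top]; trivial)
  have hDb : D b = l 1 • b := eq_smul_of_mem_flag hD hU hU0 h hb hb'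
  obtain ⟨hz1, hz2⟩ := flag_quadratic_form hD hU hU0 h (r := 2) (t := l 1) (k + 1)
    (fun j h1 h2 => hl j h1 (by omega)) (by omega) z (by rw [htop]; trivial) hz'
  have heb : ⟪e, b⟫_ℝ = 0 := (Submodule.mem_orthogonal _ _).1 hb' e heU
  have hez : ⟪e, z⟫_ℝ = 0 := (Submodule.mem_orthogonal _ _).1 hz' e (hU one_le_two heU)
  have hbz : ⟪b, z⟫_ℝ = 0 := (Submodule.mem_orthogonal _ _).1 hz' b hb
  have hbe : ⟪b, e⟫_ℝ = 0 := by rw [real_inner_comm, heb]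
  have hze : ⟪z, e⟫_ℝ = 0 := by rw [real_inner_comm, hez]
  have hzb : ⟪z, b⟫_ℝ = 0 := by rw [real_inner_comm, hbz]
  have hDze : ⟪D z, e⟫_ℝ = 0 := by rw [hD, hDe, inner_smul_right, hze, mul_zero]
  have hDzb : ⟪D z, b⟫_ℝ = 0 := by rw [hD, hDb, inner_smul_right, hzb, mul_zero]
  simp only [map_add, map_smul, hDe, hDb, inner_add_left, inner_add_right, inner_smul_left,
    inner_smul_right, heb, hez, hbz, hbe, hze, hzb, hDze, hDzb, RCLike.conj_to_real,
    mul_zero, add_zero, zero_add] at hf ⊢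
  have he0 : 0 ≤ ⟪e, e⟫_ℝ := real_inner_self_nonneg
  -- The slack in the bound is the form of `D - l 1` at `z`, times `⟪e, e⟫`. It is nonnegative, and
  -- for `e ≠ 0` it vanishes only if `z = 0`.
  have key : -l 1 * (c * (c * ⟪e, e⟫_ℝ) + ⟪b, b⟫_ℝ + ⟪z, z⟫_ℝ) * ⟪e, e⟫_ℝ -
      (l 0 - l 1) * (c * ⟪e, e⟫_ℝ) ^ 2 = (⟪D z, z⟫_ℝ - l 1 * ⟪z, z⟫_ℝ) * ⟪e, e⟫_ℝ := by
    linear_combination (-⟪e, e⟫_ℝ) * hf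
  refine ⟨?_, fun heq hne => ?_⟩
  · have := mul_nonneg (sub_nonneg.2 hz1) he0
    linarith
  · have h0 : (⟪D z, z⟫_ℝ - l 1 * ⟪z, z⟫_ℝ) * ⟪e, e⟫_ℝ = 0 := by rw [← key, heq, sub_self]
    have hee : ⟪e, e⟫_ℝ ≠ 0 := fun h => hne (inner_self_eq_zero.1 h)
    have := (mul_eq_zero.1 h0).resolve_right hee
    rw [hz2 (by linarith), add_zero]
    exact hy

end Spectral

/-! ### The skewness graph and its action on the inclusion flag -/

section SkewOperator

open scoped InnerProductSpace

variable (K V : Type*) [Field K] [AddCommGroup V] [Module K V] [Finite V] (k : ℕ)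

/-- Real functions on the set of `k`-dimensional subspaces. -/
abbrev FunctionSpace : Type _ := EuclideanSpace ℝ {S : Submodule K V // finrank K S = k}

/-- The adjacency operator of the graph on the `k`-dimensional subspaces in which skew subspaces
are adjacent. -/
noncomputable def skewOperator : FunctionSpace K V k →ₗ[ℝ] FunctionSpace K V k :=
  Matrix.toEuclideanLin (Matrix.of fun S T => if Disjoint S.1 T.1 then (1 : ℝ) else 0)

variable {K V}

/-- The indicator function of a family of `k`-dimensional subspaces. -/
noncomputable def familyIndicator (𝓕 : Set (Submodule K V)) : FunctionSpace K V k :=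
  WithLp.toLp 2 fun S => if S.1 ∈ 𝓕 then 1 else 0

variable (K V) in
/-- The span of the indicators of the families of `k`-dimensional subspaces containing some
subspace of dimension less than `j`. -/
noncomputable def inclusionFlag (j : ℕ) : Submodule ℝ (FunctionSpace K V k) :=
  Submodule.span ℝ {x | ∃ X : Submodule K V, finrank K X < j ∧ familyIndicator k (Set.Ici X) = x}

variable {k}

lemma familyIndicator_apply (𝓕 : Set (Submodule K V))
    (S : {S : Submodule K V // finrank K S = k}) :
    familyIndicator k 𝓕 S = if S.1 ∈ 𝓕 then 1 else 0 := rfl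

lemma skewOperator_apply (f : FunctionSpace K V k)
    (S : {S : Submodule K V // finrank K S = k}) :
    skewOperator K V k f S = ∑ T, (if Disjoint S.1 T.1 then 1 else 0) * f T := by
  simp [skewOperator, Matrix.toLpLin_apply, Matrix.mulVec, dotProduct]

lemma skewOperator_isSymmetric : (skewOperator K V k).IsSymmetric := by
  rw [skewOperator, Matrix.isSymmetric_toEuclideanLin_iff]
  ext S T
  simp [disjoint_comm]

lemma inclusionFlag_mono : Monotone (inclusionFlag K V k) := by
  intro i j hij
  refine Submodule.span_mono ?_
  rintro _ ⟨X, hX, rfl⟩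
  exact ⟨X, by omega, rfl⟩

lemma inclusionFlag_zero : inclusionFlag K V k 0 = ⊥ := by
  simp [inclusionFlag]

lemma inclusionFlag_one :
    inclusionFlag K V k 1 = Submodule.span ℝ {familyIndicator k Set.univ} := by
  rw [inclusionFlag]
  congr 1
  ext x
  simp [eq_comm]

lemma familyIndicator_mem_inclusionFlag {X : Submodule K V} {j : ℕ} (h : finrank K X < j) :
    familyIndicator k (Set.Ici X) ∈ inclusionFlag K V k j :=
  Submodule.subset_span ⟨X, h, rfl⟩

/-- For `X` of dimension `k`, the only `k`-subspace containing `X` is `X` itself, so the point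
masses are among the generators. -/
lemma inclusionFlag_top : inclusionFlag K V k (k + 1) = ⊤ := by
  rw [eq_top_iff]
  intro f _
  have : f = ∑ S, f S • familyIndicator k (Set.Ici S.1) := by
    ext T
    simp only [WithLp.ofLp_sum, WithLp.ofLp_smul, Finset.sum_apply, Pi.smul_apply,
      familyIndicator_apply, Set.mem_Ici, smul_eq_mul, mul_ite, mul_one, mul_zero]
    rw [sum_eq_single T]
    · simp
    · intro S _ hne
      rw [if_neg]
      intro hle
      exact hne (Subtype.ext (Submodule.eq_of_le_of_finrank_eq hle (by rw [S.2, T.2])))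
    · simp
  rw [this]
  exact Submodule.sum_mem _ fun S _ => Submodule.smul_mem _ _
    (familyIndicator_mem_inclusionFlag (by rw [S.2]; omega))

lemma skewOperator_familyIndicator_apply (S : {S : Submodule K V // finrank K S = k}) (X : Submodule K V) :
    skewOperator K V k (familyIndicator k (Set.Ici X)) S = #(skewExtensions S.1 X ⊤ k) := by
  rw [skewOperator_apply]
  simp only [familyIndicator_apply, Set.mem_Ici, ite_mul, one_mul, zero_mul, ← ite_and]
  rw [sum_boole]
  congr 1
  refine card_bij (fun T _ => T.1) ?_ ?_ ?_
  · intro T hT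
    simp only [mem_filter, mem_univ, true_and] at hT
    exact mem_skewExtensions.2 ⟨T.2, hT.2, le_top, hT.1.symm⟩
  · intro _ _ _ _ h
    exact Subtype.ext h
  · intro T hT
    obtain ⟨h1, h2, -, h3⟩ := mem_skewExtensions.1 hT
    exact ⟨⟨T, h1⟩, by simp [h2, h3.symm], rfl⟩

variable [Finite K]

/-- At `S` the left side counts the extensions of `X` skew to `S`: a constant if `X ⊓ S = ⊥`, and
none otherwise. Möbius inversion expands the condition `X ⊓ S = ⊥` as a sum over `Y ≤ X ⊓ S`. -/
lemma skewOperator_familyIndicator {X : Submodule K V} (hX : finrank K X ≤ k) :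
    skewOperator K V k (familyIndicator k (Set.Ici X)) =
      skewCount (Nat.card K) (finrank K V) k (finrank K X) k •
        ∑ Y : Submodule K V with Y ≤ X,
          subspaceMu (Nat.card K) (finrank K Y) • familyIndicator k (Set.Ici Y) := by
  ext S
  have h1 : (∑ Y : Submodule K V with Y ≤ X, subspaceMu (Nat.card K) (finrank K Y) •
      familyIndicator k (Set.Ici Y)) S = if X ⊓ S.1 = ⊥ then 1 else 0 := by
    have : Fintype V := Fintype.ofFinite V
    rw [← sum_subspaceMu]
    simp only [WithLp.ofLp_sum, WithLp.ofLp_smul, Finset.sum_apply, Pi.smul_apply,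
      familyIndicator_apply, Set.mem_Ici, smul_eq_mul, mul_ite, mul_one, mul_zero]
    rw [← sum_filter, filter_filter]
    simp only [le_inf_iff]
  rw [skewOperator_familyIndicator_apply, WithLp.ofLp_smul, Pi.smul_apply, h1]
  split_ifs with h
  · have : Fintype V := Fintype.ofFinite V
    rw [card_skewExtensions le_top le_top (disjoint_iff.2 h) hX, finrank_top, S.2]
    simp
  · have : skewExtensions S.1 X ⊤ k = ∅ := by
      refine eq_empty_of_forall_notMem fun T hT => h ?_
      obtain ⟨-, h2, -, h3⟩ := mem_skewExtensions.1 hT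
      exact disjoint_iff.1 (h3.mono_left h2)
    simp [this]

/-- The eigenvalues of the skewness graph on `k`-dimensional subspaces of an `n`-dimensional
space. -/
noncomputable def skewEigenvalue (q n k j : ℕ) : ℝ := skewCount q n k j k * subspaceMu q j

lemma skewOperator_sub_smul_mem (j : ℕ) (x : FunctionSpace K V k)
    (hx : x ∈ inclusionFlag K V k (j + 1)) :
    skewOperator K V k x - skewEigenvalue (Nat.card K) (finrank K V) k j • x ∈
      inclusionFlag K V k j := by
  induction hx using Submodule.span_induction with
  | zero => simp
  | add x y _ _ hx hy =>
    rw [map_add, smul_add, add_sub_add_comm]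
    exact add_mem hx hy
  | smul a x _ hx =>
    rw [map_smul, smul_comm, ← smul_sub]
    exact Submodule.smul_mem _ _ hx
  | mem x hx =>
    obtain ⟨X, hX, rfl⟩ := hx
    rcases lt_or_ge k (finrank K X) with hk | hk
    -- The flag is defined for all `j`, so generators with `dim X > k` also occur; they are zero.
    · have : familyIndicator k (Set.Ici X) = 0 := by
        ext S
        rw [familyIndicator_apply, if_neg]
        · rfl
        · intro h
          have := Submodule.finrank_mono (Set.mem_Ici.1 h)
          have := S.2
          omega
      simp [this]
    · rw [skewOperator_familyIndicator hk]
      rcases Nat.lt_succ_iff_lt_or_eq.1 hX with hlt | rfl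
      · refine sub_mem (Submodule.smul_mem _ _ (sum_mem fun Y hY => Submodule.smul_mem _ _
          (familyIndicator_mem_inclusionFlag ?_))) (Submodule.smul_mem _ _
          (familyIndicator_mem_inclusionFlag hlt))
        exact (Submodule.finrank_mono (mem_filter.1 hY).2).trans_lt hlt
      -- The term `Y = X` of the Möbius expansion carries the eigenvalue; every other `Y` has
      -- smaller dimension.
      · rw [← add_sum_erase _ _ (a := X) (by simp), smul_add, smul_smul, skewEigenvalue,
          add_sub_cancel_left]
        refine Submodule.smul_mem _ _ (sum_mem fun Y hY => Submodule.smul_mem _ _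
          (familyIndicator_mem_inclusionFlag ?_))
        obtain ⟨hne, hY⟩ := mem_erase.1 hY
        exact Submodule.finrank_lt_finrank_of_lt (lt_of_le_of_ne (mem_filter.1 hY).2 hne)

end SkewOperator

/-! ### The least eigenvalue -/

section Eigenvalues

/-- These are the moduli of consecutive eigenvalues. After the common factors cancel, the claim is
`q ^ j * (q ^ k - q ^ j) < q ^ n - q ^ (k + j)`, which holds because `q ^ n ≥ q ^ (k + j + 1) ≥ 2 *
q ^ (k + j)`. -/
lemma pow_choose_mul_skewCount_lt {q : ℕ} (hq : 2 ≤ q) {n k j : ℕ} (hn : 2 * k < n)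
    (hjk : j < k) :
    (q : ℝ) ^ ((j + 1).choose 2) * skewCount q n k (j + 1) k <
      (q : ℝ) ^ (j.choose 2) * skewCount q n k j k := by
  have hq1 : (1 : ℝ) < q := by exact_mod_cast hq
  have hq2 : (2 : ℝ) ≤ q := by exact_mod_cast hq
  have hs := skewCount_succ hq1 n k hjk
  have hpos := skewCount_pos hq1 (w := n) (s := k) (k := k) (j + 1) (by omega)
  have h1 : (0 : ℝ) < (q : ℝ) ^ k - (q : ℝ) ^ j := sub_pos.2 (pow_lt_pow_right₀ hq1 hjk)
  have h2 : (q : ℝ) ^ j * ((q : ℝ) ^ k - (q : ℝ) ^ j) < (q : ℝ) ^ n - (q : ℝ) ^ (k + j) := by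
    have h3 : (q : ℝ) ^ (k + j + 1) ≤ (q : ℝ) ^ n := pow_le_pow_right₀ hq1.le (by omega)
    have h4 : (0 : ℝ) < (q : ℝ) ^ j := by positivity
    have h5 : (0 : ℝ) < (q : ℝ) ^ (k + j) := by positivity
    rw [pow_succ] at h3
    have h6 := mul_le_mul_of_nonneg_left hq2 h5.le
    have h7 := mul_pos h4 h4
    rw [pow_add] at *
    linarith
  have h3 : (q : ℝ) ^ j * skewCount q n k (j + 1) k < skewCount q n k j k := by
    refine lt_of_mul_lt_mul_right ?_ h1.le
    rw [hs]
    have := mul_lt_mul_of_pos_right h2 hpos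
    linarith
  rw [Nat.choose_succ_succ' j 1, Nat.choose_one_right, pow_add]
  have := mul_lt_mul_of_pos_left h3 (show (0 : ℝ) < (q : ℝ) ^ (j.choose 2) by positivity)
  linarith

lemma skewEigenvalue_one_lt {q : ℕ} (hq : 2 ≤ q) {n k : ℕ} (hn : 2 * k < n) {j : ℕ} (hj : 2 ≤ j)
    (hjk : j ≤ k) : skewEigenvalue q n k 1 < skewEigenvalue q n k j := by
  have hq1 : (1 : ℝ) < q := by exact_mod_cast hq
  have key : (q : ℝ) ^ (j.choose 2) * skewCount q n k j k < skewCount q n k 1 k := by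
    induction j, hj using Nat.le_induction with
    | base => simpa using pow_choose_mul_skewCount_lt hq hn hjk
    | succ j _ ih =>
      exact (pow_choose_mul_skewCount_lt hq hn hjk).trans (ih (by omega))
  have hpos := skewCount_pos hq1 (w := n) (s := k) (k := k) j (by omega)
  have h2 : (0 : ℝ) < (q : ℝ) ^ (j.choose 2) * skewCount q n k j k := by positivity
  rw [skewEigenvalue, skewEigenvalue, subspaceMu, subspaceMu]
  rcases neg_one_pow_eq_or ℝ j with h | h <;> rw [h] <;> norm_num <;> linarith

end Eigenvalues

/-! ### The upper bound -/

section RatioBound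

open scoped InnerProductSpace

variable {K V : Type*} [Field K] [AddCommGroup V] [Module K V] [Finite V] {k : ℕ}

lemma inner_familyIndicator (𝓐 𝓑 : Set (Submodule K V)) :
    ⟪familyIndicator k 𝓐, familyIndicator k 𝓑⟫_ℝ =
      ({S | finrank K S = k ∧ S ∈ 𝓐 ∧ S ∈ 𝓑} : Set (Submodule K V)).ncard := by
  simp only [PiLp.inner_apply, familyIndicator_apply, RCLike.inner_apply, RCLike.conj_to_real,
    mul_ite, mul_one, mul_zero, ← ite_and]
  rw [sum_boole, Set.ncard_eq_toFinset_card']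
  congr 1
  refine card_bij (fun T _ => T.1) ?_ ?_ ?_
  · intro T hT
    simp only [mem_filter, mem_univ, true_and] at hT
    simp [T.2, hT]
  · intro _ _ _ _ h
    exact Subtype.ext h
  · intro T hT
    simp only [Set.mem_toFinset, Set.mem_ofPred_eq] at hT
    exact ⟨⟨T, hT.1⟩, by simp [hT.2], rfl⟩

lemma inner_skewOperator_familyIndicator {𝓕 : Set (Submodule K V)}
    (h : ∀ S ∈ 𝓕, ∀ T ∈ 𝓕, ¬ Disjoint S T) :
    ⟪skewOperator K V k (familyIndicator k 𝓕), familyIndicator k 𝓕⟫_ℝ = 0 := by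
  rw [PiLp.inner_apply]
  refine sum_eq_zero fun S _ => ?_
  rw [skewOperator_apply, familyIndicator_apply]
  split_ifs with hS
  · rw [sum_eq_zero, inner_zero_left]
    intro T _
    rw [familyIndicator_apply]
    split_ifs with h1 h2 <;> simp
    exact h _ hS _ h2 h1
  · rw [inner_zero_right]

variable [Finite K]

lemma ncard_finrank_eq_le {X : Submodule K V} (hX : finrank K X ≤ k) :
    (({S | finrank K S = k ∧ X ≤ S} : Set (Submodule K V)).ncard : ℝ) =
      skewCount (Nat.card K) (finrank K V) 0 (finrank K X) k := by
  have : Fintype V := Fintype.ofFinite V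
  have h := card_skewExtensions (S := ⊥) (W := ⊤) bot_le le_top (disjoint_bot_right (a := X)) hX
  rw [finrank_top, finrank_bot] at h
  rw [← h, Set.ncard_eq_toFinset_card']
  congr 2
  ext T
  simp [mem_skewExtensions]

/-- Used with `A = q ^ k`, `B = q ^ n`, `c₀ = l 0`, `c₁ = -l 1`, `N` the number of all `k`-subspaces
and `d` the number through a given line. The hypotheses give `c₀ + c₁ = c₁ * (B - 1) / (A - 1)`, so
Hoffman's value `c₁ * N / (c₀ + c₁)` equals `d`. -/
lemma le_and_eq_of_ratio_bound {A B N d c₀ c₁ f : ℝ} (hc : c₀ * (A - 1) = (B - A) * c₁)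
    (hd : N * (A - 1) = (B - 1) * d) (hc₁ : 0 < c₁) (hd₀ : 0 < d) (ha : 0 < A - 1)
    (hb : 0 < B - 1) (hf : 0 ≤ f) :
    ((c₀ + c₁) * f ^ 2 ≤ c₁ * f * N → f ≤ d) ∧ (f = d → (c₀ + c₁) * f ^ 2 = c₁ * f * N) := by
  have key : (c₀ + c₁) * f ^ 2 * (A - 1) ^ 2 - c₁ * f * N * (A - 1) ^ 2 =
      c₁ * f * ((A - 1) * (B - 1)) * (f - d) := by
    linear_combination (f ^ 2 * (A - 1)) * hc - (c₁ * f * (A - 1)) * hd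
  refine ⟨fun h => ?_, fun heq => ?_⟩
  · rcases hf.eq_or_lt with h0 | h0
    · rw [← h0]; exact hd₀.le
    · by_contra! hlt
      have h3 : 0 < c₁ * f * ((A - 1) * (B - 1)) * (f - d) := by
        have := sub_pos.2 hlt
        positivity
      have h4 := mul_le_mul_of_nonneg_right h (sq_nonneg (A - 1))
      linarith
  · rw [heq, sub_self, mul_zero] at key
    subst heq
    refine mul_right_cancel₀ (pow_ne_zero 2 ha.ne') ?_
    linarith

theorem ncard_intersecting_le (hk : 1 ≤ k) (hn : 2 * k < finrank K V)
    {𝓕 : Set (Submodule K V)} (h𝓕 : ∀ S ∈ 𝓕, finrank K S = k)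
    (hint : ∀ S ∈ 𝓕, ∀ T ∈ 𝓕, ¬ Disjoint S T) :
    (𝓕.ncard : ℝ) ≤ skewCount (Nat.card K) (finrank K V) 0 1 k ∧
      ((𝓕.ncard : ℝ) = skewCount (Nat.card K) (finrank K V) 0 1 k →
        familyIndicator k 𝓕 ∈ inclusionFlag K V k 2) := by
  have hq := one_lt_card_real (K := K)
  have hq2 : 2 ≤ Nat.card K := Finite.one_lt_card
  obtain ⟨h1, h2⟩ := flag_ratio_bound (D := skewOperator K V k) (U := inclusionFlag K V k)
    (l := skewEigenvalue (Nat.card K) (finrank K V) k) (k := k)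
    (e := familyIndicator k Set.univ) (f := familyIndicator k 𝓕)
    skewOperator_isSymmetric inclusionFlag_mono inclusionFlag_zero skewOperator_sub_smul_mem hk
    inclusionFlag_top (fun _ => skewEigenvalue_one_lt hq2 hn) inclusionFlag_one
    (inner_skewOperator_familyIndicator hint)
  have e1 : ({S | finrank K S = k ∧ S ∈ Set.univ ∧ S ∈ 𝓕} : Set (Submodule K V)) = 𝓕 := by
    ext S; simpa using h𝓕 S
  have e2 : ({S | finrank K S = k ∧ S ∈ 𝓕 ∧ S ∈ 𝓕} : Set (Submodule K V)) = 𝓕 := by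
    ext S; simpa using h𝓕 S
  have e3 : ({S | finrank K S = k ∧ S ∈ Set.univ ∧ S ∈ Set.univ} : Set (Submodule K V)) =
      {S : Submodule K V | finrank K S = k ∧ ⊥ ≤ S} := by
    ext S; simp
  have hN := ncard_finrank_eq_le (K := K) (V := V) (X := ⊥) (k := k) (by simp)
  rw [finrank_bot] at hN
  have hne : familyIndicator k (Set.univ : Set (Submodule K V)) ≠ 0 := by
    intro h
    have h3 := inner_familyIndicator (K := K) (V := V) (k := k) Set.univ Set.univ
    rw [h, inner_zero_left, e3, hN] at h3
    exact (skewCount_pos hq 0 (by omega)).ne h3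
  simp only [inner_familyIndicator, e1, e2, e3, hN, skewEigenvalue, subspaceMu_succ] at h1 h2
  simp only [subspaceMu, Nat.choose_zero_succ, pow_zero, mul_one, mul_neg, sub_neg_eq_add,
    neg_neg] at h1 h2
  have hc := skewCount_succ hq (finrank K V) k (show 0 < k by omega)
  have hd := skewCount_succ hq (finrank K V) 0 (show 0 < k by omega)
  have hc1 := skewCount_pos hq (w := finrank K V) (s := k) (k := k) 1 (by omega)
  have hd1 := skewCount_pos hq (w := finrank K V) (s := 0) (k := k) 1 (by omega)
  have ha : (0 : ℝ) < (Nat.card K : ℝ) ^ k - 1 := sub_pos.2 (one_lt_pow₀ hq (by omega))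
  have hb : (0 : ℝ) < (Nat.card K : ℝ) ^ finrank K V - 1 :=
    sub_pos.2 (one_lt_pow₀ hq (by omega))
  simp only [zero_add, add_zero, pow_zero] at hc hd h1 h2
  obtain ⟨h3, h4⟩ := le_and_eq_of_ratio_bound hc hd hc1 hd1 ha hb (Nat.cast_nonneg 𝓕.ncard)
  exact ⟨h3 h1, fun h => h2 (h4 h) hne⟩

end RatioBound

/-! ### The families attaining the bound -/

section EqualityCase

variable {K V : Type*} [Field K] [AddCommGroup V] [Module K V] [Finite V] [Fintype V] [Finite K]
  {k : ℕ}

/-- The generators are the constant `1` and the indicators of `X ≤ S` for lines `X`. Spread the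
weight `1` evenly over the `q ^ k - 1` nonzero vectors of `S`, respectively the `q - 1` nonzero
vectors of `X`. -/
lemma exists_sum_of_mem_inclusionFlag_two (hk : 1 ≤ k) {f : FunctionSpace K V k}
    (hf : f ∈ inclusionFlag K V k 2) :
    ∃ g : V → ℝ, (∀ c : K, c ≠ 0 → ∀ v, g (c • v) = g v) ∧
      ∀ S, f S = ∑ v : V with v ∈ S.1 ∧ v ≠ 0, g v := by
  have hq := one_lt_card_real (K := K)
  induction hf using Submodule.span_induction with
  | zero => exact ⟨0, by simp, by simp⟩
  | add x y _ _ hx hy =>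
    obtain ⟨g, hg, hx⟩ := hx
    obtain ⟨g', hg', hy⟩ := hy
    exact ⟨g + g', fun c hc v => by simp [hg c hc, hg' c hc], fun S => by
      simp [hx, hy, sum_add_distrib]⟩
  | smul a x _ hx =>
    obtain ⟨g, hg, hx⟩ := hx
    exact ⟨a • g, fun c hc v => by simp [hg c hc], fun S => by simp [hx, mul_sum]⟩
  | mem x hx =>
    obtain ⟨X, hX, rfl⟩ := hx
    rcases Nat.le_one_iff_eq_zero_or_eq_one.1 (Nat.lt_succ_iff.1 hX) with h | h
    · refine ⟨fun _ => ((Nat.card K : ℝ) ^ k - 1)⁻¹, fun _ _ _ => rfl, fun S => ?_⟩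
      have : (0 : ℝ) < (Nat.card K : ℝ) ^ k - 1 := sub_pos.2 (one_lt_pow₀ hq (by omega))
      rw [sum_const, nsmul_eq_mul, card_vectors_ne_zero, S.2, mul_inv_cancel₀ this.ne',
        familyIndicator_apply, Submodule.finrank_eq_zero.1 h]
      simp
    · refine ⟨fun v => if v ∈ X then ((Nat.card K : ℝ) - 1)⁻¹ else 0, fun c hc v => ?_,
        fun S => ?_⟩
      · simp only [X.smul_mem_iff hc]
      · rw [familyIndicator_apply, ← sum_filter, filter_filter]
        simp only [Set.mem_Ici]
        split_ifs with hXS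
        · have : (univ.filter fun v : V => (v ∈ S.1 ∧ v ≠ 0) ∧ v ∈ X) =
              univ.filter fun v : V => v ∈ X ∧ v ≠ 0 := by
            ext v
            have := @hXS v
            simp only [mem_filter, mem_univ, true_and]
            tauto
          rw [this, sum_const, nsmul_eq_mul, card_vectors_ne_zero, h, pow_one, mul_inv_cancel₀]
          linarith
        · refine (sum_eq_zero fun v hv => ?_).symm
          simp only [mem_filter, mem_univ, true_and] at hv
          refine absurd ?_ hXS
          have h1 : Submodule.span K {v} = X :=
            Submodule.eq_of_le_of_finrank_eq (by simpa using hv.2)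
              (by rw [h, finrank_span_singleton hv.1.2])
          rw [← h1]
          simpa using hv.1.1

lemma sum_sum_vectors (A : Finset (Submodule K V)) {W : Submodule K V} (hA : ∀ T ∈ A, T ≤ W)
    (g : V → ℝ) :
    ∑ T ∈ A, ∑ v : V with v ∈ T ∧ v ≠ 0, g v =
      ∑ v : V with v ∈ W ∧ v ≠ 0, (#{T ∈ A | v ∈ T} : ℝ) * g v := by
  have : ∀ T ∈ A, ∑ v : V with v ∈ T ∧ v ≠ 0, g v =
      ∑ v : V with v ∈ W ∧ v ≠ 0, if v ∈ T then g v else 0 := by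
    intro T hT
    rw [← sum_filter, filter_filter]
    refine sum_congr ?_ fun _ _ => rfl
    ext v
    have := @hA T hT v
    simp only [mem_filter, mem_univ, true_and]
    tauto
  rw [sum_congr rfl this, sum_comm]
  refine sum_congr rfl fun v _ => ?_
  rw [← sum_filter, sum_const, nsmul_eq_mul]

/-- This is injectivity of the point-hyperplane incidence map of `W`. Summing over all hyperplanes
shows that `g` has total zero on `W`. Summing over those through `u` weights vectors off `span {u}`
less than vectors on it, so subtracting a multiple of the total leaves a nonzero multiple of `g u`.
-/
lemma eq_zero_of_hyperplane_sums {W : Submodule K V} (hW : finrank K W = k + 1) (hk : 1 ≤ k)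
    {g : V → ℝ} (hg : ∀ c : K, c ≠ 0 → ∀ v, g (c • v) = g v)
    (h : ∀ T ≤ W, finrank K T = k → ∑ v : V with v ∈ T ∧ v ≠ 0, g v = 0)
    {u : V} (hu : u ∈ W) (hu0 : u ≠ 0) : g u = 0 := by
  have hq := one_lt_card_real (K := K)
  have huW : Submodule.span K {u} ≤ W := by simpa using hu
  have ha := skewCount_pos hq (w := k + 1) (s := 0) (k := k) 1 (by omega)
  have he := skewCount_pos hq (w := k + 1) (s := 1) (k := k) 1 (by omega)
  have hcount : ∀ v ∈ W, v ≠ 0 →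
      (#(skewExtensions ⊥ (Submodule.span K {v}) W k) : ℝ) =
        skewCount (Nat.card K) (k + 1) 0 1 k := by
    intro v hv hv0
    rw [card_skewExtensions bot_le (by simpa using hv) disjoint_bot_right
      (by rwa [finrank_span_singleton hv0]), hW, finrank_bot, finrank_span_singleton hv0]
  have h1 : ∑ v : V with v ∈ W ∧ v ≠ 0, g v = 0 := by
    have := sum_sum_vectors (skewExtensions ⊥ ⊥ W k) (W := W)
      (fun T hT => (mem_skewExtensions.1 hT).2.2.1) g
    rw [sum_eq_zero fun T hT => h T (mem_skewExtensions.1 hT).2.2.1 (mem_skewExtensions.1 hT).1,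
      sum_congr rfl (g := fun v => skewCount (Nat.card K) (k + 1) 0 1 k * g v), ← mul_sum] at this
    · exact (mul_eq_zero.1 this.symm).resolve_left ha.ne'
    · intro v hv
      simp only [mem_filter, mem_univ, true_and] at hv
      rw [← hcount v hv.1 hv.2]
      congr 3
      ext T
      simp only [mem_filter, mem_skewExtensions, Submodule.span_singleton_le_iff_mem, bot_le,
        disjoint_bot_right]
      tauto
  -- The coefficient of `g v` is the number of hyperplanes through both `u` and `v`: all those
  -- through `u`, minus those that miss `v`.
  have h2 : ∑ v : V with v ∈ W ∧ v ≠ 0,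
      (skewCount (Nat.card K) (k + 1) 0 1 k -
        if v ∈ Submodule.span K {u} then 0 else skewCount (Nat.card K) (k + 1) 1 1 k) * g v = 0 := by
    have := sum_sum_vectors (skewExtensions ⊥ (Submodule.span K {u}) W k) (W := W)
      (fun T hT => (mem_skewExtensions.1 hT).2.2.1) g
    rw [sum_eq_zero fun T hT => h T (mem_skewExtensions.1 hT).2.2.1 (mem_skewExtensions.1 hT).1]
      at this
    refine Eq.trans ?_ this.symm
    refine sum_congr rfl fun v hv => ?_
    simp only [mem_filter, mem_univ, true_and] at hv
    congr 1
    rw [← hcount u hu hu0, sub_eq_iff_eq_add,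
      ← card_filter_add_card_filter_not (s := skewExtensions ⊥ (Submodule.span K {u}) W k)
        (fun T => v ∈ T), Nat.cast_add]
    congr 1
    split_ifs with hvu
    · rw [Nat.cast_eq_zero, card_eq_zero, filter_eq_empty_iff]
      intro T hT
      simpa using (mem_skewExtensions.1 hT).2.1 hvu
    · have hd : Disjoint (Submodule.span K {u}) (Submodule.span K {v}) :=
        (Submodule.disjoint_span_singleton' hv.2).2 hvu
      have hc := card_skewExtensions (W := W) (k := k) (by simpa using hv.1) huW hd
        (by rwa [finrank_span_singleton hu0])
      rw [hW, finrank_span_singleton hu0, finrank_span_singleton hv.2] at hc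
      rw [← hc]
      congr 2
      ext T
      simp only [mem_filter, mem_skewExtensions, disjoint_bot_right, and_true,
        Submodule.disjoint_span_singleton' hv.2]
      tauto
  have h3 : ∑ v : V with v ∈ Submodule.span K {u} ∧ v ≠ 0, g v =
      ((Nat.card K : ℝ) - 1) * g u := by
    have hc := card_vectors_ne_zero (Submodule.span K {u})
    rw [finrank_span_singleton hu0, pow_one] at hc
    rw [← hc, ← nsmul_eq_mul, ← sum_const]
    refine sum_congr rfl fun v hv => ?_
    simp only [mem_filter, mem_univ, true_and] at hv
    obtain ⟨c, rfl⟩ := Submodule.mem_span_singleton.1 hv.1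
    exact hg c (fun hc => hv.2 (by rw [hc, zero_smul])) u
  have h4 : ∑ v : V with v ∈ W ∧ v ≠ 0, (if v ∈ Submodule.span K {u} then g v else 0) =
      ∑ v : V with v ∈ Submodule.span K {u} ∧ v ≠ 0, g v := by
    rw [← sum_filter, filter_filter]
    refine sum_congr ?_ fun _ _ => rfl
    ext v
    have := @huW v
    simp only [mem_filter, mem_univ, true_and]
    tauto
  have h5 : ∀ v, (skewCount (Nat.card K) (k + 1) 0 1 k -
        if v ∈ Submodule.span K {u} then 0 else skewCount (Nat.card K) (k + 1) 1 1 k) * g v =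
      (skewCount (Nat.card K) (k + 1) 0 1 k - skewCount (Nat.card K) (k + 1) 1 1 k) * g v +
        skewCount (Nat.card K) (k + 1) 1 1 k *
          if v ∈ Submodule.span K {u} then g v else 0 := by
    intro v
    split_ifs <;> ring
  rw [sum_congr rfl fun v _ => h5 v, sum_add_distrib, ← mul_sum, ← mul_sum, h1, mul_zero,
    zero_add, h4, h3] at h2
  exact ((mul_eq_zero.1 ((mul_eq_zero.1 h2).resolve_left he.ne')).resolve_left
    (by linarith))

theorem exists_mem_of_familyIndicator_mem (hk : 1 ≤ k) (hn : 2 * k < finrank K V)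
    {𝓕 : Set (Submodule K V)} (h𝓕 : ∀ S ∈ 𝓕, finrank K S = k) (hne : 𝓕.Nonempty)
    (hint : ∀ S ∈ 𝓕, ∀ T ∈ 𝓕, ¬ Disjoint S T)
    (hmem : familyIndicator k 𝓕 ∈ inclusionFlag K V k 2) :
    ∃ v : V, v ≠ 0 ∧ ∀ S ∈ 𝓕, v ∈ S := by
  by_contra! hcon
  obtain ⟨g, hg, hsum⟩ := exists_sum_of_mem_inclusionFlag_two hk hmem
  obtain ⟨S₀, hS₀⟩ := hne
  have h1 := hsum ⟨S₀, h𝓕 S₀ hS₀⟩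
  rw [familyIndicator_apply, if_pos hS₀, sum_eq_zero] at h1
  · exact one_ne_zero h1
  intro u hu
  simp only [mem_filter, mem_univ, true_and] at hu
  obtain ⟨S, hS, huS⟩ := hcon u hu.2
  -- The number of `(k + 1)`-subspaces through `u` skew to `S` is positive because `k + (k + 1) ≤
  -- n`.
  have hc := card_skewExtensions (S := S) (X := Submodule.span K {u}) (W := ⊤) (k := k + 1)
    le_top le_top ((Submodule.disjoint_span_singleton' hu.2).2 huS).symm
    (by rw [finrank_span_singleton hu.2]; omega)
  rw [finrank_span_singleton hu.2, h𝓕 S hS, finrank_top] at hc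
  have hpos := skewCount_pos (one_lt_card_real (K := K)) (w := finrank K V) (s := k) (k := k + 1) 1
    (by omega)
  rw [← hc, Nat.cast_pos, card_pos] at hpos
  obtain ⟨W, hW⟩ := hpos
  obtain ⟨hW, huW, -, hWS⟩ := mem_skewExtensions.1 hW
  refine eq_zero_of_hyperplane_sums hW hk hg (fun T hTW hT => ?_) (by simpa using huW) hu.2
  rw [← hsum ⟨T, hT⟩, familyIndicator_apply, if_neg]
  exact fun h => hint T h S hS (hWS.mono_left hTW)

end EqualityCase

/-! ### Gaussian binomials as subspace counts -/

section GaussianBinomial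

lemma qFactorial_succ (q n : ℕ) : qFactorial q (n + 1) = qFactorial q n * qBracket q (n + 1) := by
  rw [qFactorial, qFactorial, prod_Icc_succ_top (by omega)]

lemma qBracket_ne_zero {q n : ℕ} (hq : 2 ≤ q) (hn : n ≠ 0) : qBracket q n ≠ 0 := by
  have h1 : (1 : ℚ) < q := by exact_mod_cast hq
  have h2 := one_lt_pow₀ h1 hn
  exact div_ne_zero (by linarith) (by linarith)

lemma qFactorial_ne_zero {q : ℕ} (hq : 2 ≤ q) (n : ℕ) : qFactorial q n ≠ 0 :=
  prod_ne_zero_iff.2 fun _ hi => qBracket_ne_zero hq (by have := mem_Icc.1 hi; omega)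

lemma gaussianBinomial_zero_right {q : ℕ} (hq : 2 ≤ q) (n : ℕ) : gaussianBinomial q n 0 = 1 := by
  have h : qFactorial q 0 = 1 := by simp [qFactorial]
  rw [gaussianBinomial, if_pos n.zero_le, Nat.sub_zero, h, mul_one,
    div_self (qFactorial_ne_zero hq n)]

lemma gaussianBinomial_succ {q : ℕ} (hq : 2 ≤ q) {n r : ℕ} (h : r ≤ n) :
    gaussianBinomial q (n + 1) (r + 1) * ((q : ℚ) ^ (r + 1) - 1) =
      ((q : ℚ) ^ (n + 1) - 1) * gaussianBinomial q n r := by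
  have h1 : (1 : ℚ) < q := by exact_mod_cast hq
  have h2 := one_lt_pow₀ h1 (n := r + 1) (by omega)
  rw [gaussianBinomial, gaussianBinomial, if_pos h, if_pos (by omega), Nat.add_sub_add_right,
    qFactorial_succ, qFactorial_succ, qBracket, qBracket]
  have h3 := qFactorial_ne_zero hq r
  have h4 := qFactorial_ne_zero hq (n - r)
  have h5 : (1 : ℚ) - q ≠ 0 := by linarith
  have h6 : (1 : ℚ) - (q : ℚ) ^ (r + 1) ≠ 0 := by linarith
  field_simp
  ring

theorem gaussianBinomial_eq_skewCount {q : ℕ} (hq : 2 ≤ q) {n r : ℕ} (h : r ≤ n) :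
    (gaussianBinomial q n r : ℝ) = skewCount q (n + 1) 0 1 (r + 1) := by
  have h1 : (1 : ℝ) < q := by exact_mod_cast hq
  induction r generalizing n with
  | zero => rw [gaussianBinomial_zero_right hq, skewCount_self, Rat.cast_one]
  | succ r ih =>
    obtain ⟨n, rfl⟩ : ∃ m, n = m + 1 := ⟨n - 1, by omega⟩
    -- Cancelling one `q` in each factor passes to the quotient by a line; the two counts then
    -- satisfy the same recursion as the Gaussian binomials.
    have h2 : skewCount q (n + 1 + 1) 0 1 (r + 1 + 1) = skewCount q (n + 1) 0 0 (r + 1) := by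
      rw [skewCount, skewCount, ← prod_Ico_add' _ 0 (r + 1) 1]
      refine prod_congr rfl fun i _ => ?_
      have h0 : (q : ℝ) ≠ 0 := by linarith
      rw [eq_comm, ← mul_div_mul_right _ _ h0]
      congr 1 <;> ring
    have h3 := skewCount_succ h1 (n + 1) 0 (show 0 < r + 1 by omega)
    have h4 := gaussianBinomial_succ hq (show r ≤ n by omega)
    have h5 := one_lt_pow₀ h1 (n := r + 1) (by omega)
    rw [h2]
    apply_fun ((↑) : ℚ → ℝ) at h4
    push_cast at h4
    rw [ih (by omega)] at h4
    simp only [zero_add, pow_zero] at h3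
    exact mul_right_cancel₀ (by linarith) (h4.trans h3.symm)

end GaussianBinomial

end SubspaceEKR

theorem mainTheorem6 {K : Type*} [Field K] [Finite K] (q : ℕ) (hq : Nat.card K = q)
    (n k : ℕ) (hk : 1 ≤ k) (hkn : 2 * k < n)
    (𝓕 : Set (Submodule K (Fin n → K)))
    (h𝓕 : 𝓕 ⊆ SubspaceEKR.subspacesOfDim K n k)
    (hint : SubspaceEKR.IsIntersecting 𝓕) :
    (𝓕.ncard : ℚ) ≤ SubspaceEKR.gaussianBinomial q (n - 1) (k - 1) ∧
      ((𝓕.ncard : ℚ) = SubspaceEKR.gaussianBinomial q (n - 1) (k - 1) ↔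
        SubspaceEKR.IsCanonicallyIntersecting k 𝓕) := by
  subst hq
  have : Fintype (Fin n → K) := Fintype.ofFinite _
  have hrank : Module.finrank K (Fin n → K) = n := by simp
  have hq2 : 2 ≤ Nat.card K := Finite.one_lt_card
  have hG := SubspaceEKR.gaussianBinomial_eq_skewCount hq2 (show k - 1 ≤ n - 1 by omega)
  rw [show n - 1 + 1 = n by omega, show k - 1 + 1 = k by omega] at hG
  have hint' : ∀ S ∈ 𝓕, ∀ T ∈ 𝓕, ¬ Disjoint S T := fun S hS T hT hd =>
    hint S hS T hT (by rw [SubspaceEKR.Skew, disjoint_iff.1 hd, finrank_bot])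
  obtain ⟨hle, heq⟩ := SubspaceEKR.ncard_intersecting_le hk (by rwa [hrank]) h𝓕 hint'
  rw [hrank, ← hG] at hle heq
  have hcard : ∀ ℓ : Submodule K (Fin n → K), Module.finrank K ℓ = 1 →
      ({S ∈ SubspaceEKR.subspacesOfDim K n k | ℓ ≤ S}.ncard : ℝ) =
        SubspaceEKR.gaussianBinomial (Nat.card K) (n - 1) (k - 1) := by
    intro ℓ hℓ
    have := SubspaceEKR.ncard_finrank_eq_le (X := ℓ) (k := k) (by omega)
    rw [hrank, hℓ, ← hG] at this
    exact this
  refine ⟨by exact_mod_cast hle, fun h => ?_, ?_⟩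
  · have hreal : (𝓕.ncard : ℝ) = SubspaceEKR.gaussianBinomial (Nat.card K) (n - 1) (k - 1) := by
      exact_mod_cast congrArg ((↑) : ℚ → ℝ) h
    have hne : 𝓕.Nonempty := by
      rw [Set.nonempty_iff_ne_empty]
      rintro rfl
      rw [hG] at hreal
      have := SubspaceEKR.skewCount_pos (SubspaceEKR.one_lt_card_real (K := K)) (w := n) (s := 0) (k := k) 1 (by omega)
      rw [← hreal] at this
      simp at this
    obtain ⟨v, hv, hmem⟩ := SubspaceEKR.exists_mem_of_familyIndicator_mem hk (by rwa [hrank]) h𝓕 hne hint'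
      (heq hreal)
    have hℓ : Module.finrank K (Submodule.span K {v}) = 1 := finrank_span_singleton hv
    -- The family lies in the star of the line spanned by the common vector, and the two have the
    -- same size.
    refine ⟨Submodule.span K {v}, hℓ, Set.eq_of_subset_of_ncard_le
      (fun S hS => ⟨h𝓕 hS, by simpa using hmem S hS⟩) ?_⟩
    exact_mod_cast ((hcard _ hℓ).trans hreal.symm).le
  · rintro ⟨ℓ, hℓ, rfl⟩
    exact_mod_cast hcard ℓ hℓ
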